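/- Let $\mathbb{K}$ be an algebraically closed field of characteristic $0$, and let $p\in\mathbb{K}[x,y]\setminus(\mathbb{K}[x]\cup\mathbb{K}[y])$ be irreducible. Let $\mathbb{K}[x,y]_p$ be the ring of rational functions in $\mathbb{K}(x,y)$ whose (reduced) denominator is not divisible by $p$, and let $\langle p\rangle$ be the ideal generated by $p$ therein. Let $r\in\mathbb{K}[x,y]_p$, and let $(f,g)\in\mathbb{K}(x)\times\mathbb{K}(y)$ be such that $f-g\in r+\langle p\rangle$. Let $C\subseteq\mathbb{P}^1(\mathbb{K})\times\mathbb{P}^1(\mathbb{K})$ be the curve defined by the bi-homogenization $x_0^{\deg_x p}y_0^{\deg_y p}\,p(x_1/x_0,y_1/y_0)$ of $p$. The orbit of a point of $C$ is its equivalence class under the smallest equivalence relation $\sim$ on $C$ such that $(a,b)\sim(c,d)$ whenever $a=c$ or $b=d$. If $(\infty,\infty)\in C$, it is called a pole of $r$ if there is a Puiseux series $\varphi$ over $\mathbb{K}$ in $x^{-1}$ such that $p(x,\varphi)=0$, $\deg\varphi>0$ and $\deg r(x,\varphi)>0$. A point $(s_1,s_2)\in C$ is called a pole of $r$ if there is a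 transformation $T:(x,y)\mapsto\left(\frac{a_1x+b_1}{c_1x+d_1},\frac{a_2y+b_2}{c_2y+d_2}\right)$ of $\mathbb{P}^1(\mathbb{K})\times\mathbb{P}^1(\mathbb{K})$ (with $a_i,b_i,c_i,d_i\in\mathbb{K}$, $a_id_i-b_ic_i\neq0$) that maps $(s_1,s_2)$ to $(\infty,\infty)$ and such that $(\infty,\infty)$ is, in the sense above, a pole of $r\circ T^{-1}$ on the curve associated with the numerator of $p\circ T^{-1}$. If the orbit of a pole of $r$ is infinite, then there is a pole $(t_1,t_2)$ of $r$ in this orbit such that $t_1$ is not a pole of $f$ or $t_2$ is not a pole of $g$. -/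

import Mathlib

open Polynomial
open scoped Polynomial.Bivariate OnePoint

noncomputable section

namespace SepVar

/-- The field `K(x, y)`: the field of fractions of `K[x, y]`. In `K[X][Y]` the variable `x` is `C X`
(the inner one) and `y` is `Y` (the outer one). -/
abbrev RatFunc₂ (K : Type*) [Field K] : Type _ := FractionRing K[X][Y]

variable {K : Type*} [Field K]

/-- The numerator `r_n` of a rational function in reduced form. -/
abbrev numer (r : RatFunc₂ K) : K[X][Y] := IsFractionRing.num K[X][Y] r

/-- The denominator `r_d` of a rational function in reduced form. -/
abbrev denom (r : RatFunc₂ K) : K[X][Y] := (IsFractionRing.den K[X][Y] r : K[X][Y])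

/-- The inclusion `K[x, y] ⊆ K(x, y)`. -/
abbrev ofPoly (p : K[X][Y]) : RatFunc₂ K := algebraMap K[X][Y] (RatFunc₂ K) p

/-- The variable `x` as an element of `K(x, y)`. -/
def varX : RatFunc₂ K := ofPoly (C X)

/-- The variable `y` as an element of `K(x, y)`. -/
def varY : RatFunc₂ K := ofPoly Y

/-- The value `r(u, v)` of `r ∈ K(x, y)` at elements `u, v` of a field extension of `K`, meaningful
when the denominator of `r` does not vanish at `(u, v)`. -/
def evalRat {L : Type*} [Field L] [Algebra K L] (u v : L) (r : RatFunc₂ K) : L :=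
  aevalAeval u v (numer r) / aevalAeval u v (denom r)

/-! ### Separated multiples modulo `p` -/

/-- The local ring `K[x, y]_p`: the rational functions whose denominator is not divisible by `p`. -/
def localRing (p : K[X][Y]) : Set (RatFunc₂ K) := {r | ¬ p ∣ denom r}

/-- The ideal `⟨p⟩` that `p` generates in `K[x, y]_p`. -/
def localIdeal (p : K[X][Y]) : Set (RatFunc₂ K) := {s | ∃ q ∈ localRing p, s = q * ofPoly p}

/-- The set `F(r, p)` of all `(f, g) ∈ K(x) × K(y)` such that `f - g ∈ r + ⟨p⟩`. -/
def sepSet (r : RatFunc₂ K) (p : K[X][Y]) : Set (RatFunc K × RatFunc K) :=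
  {fg | ∃ s ∈ localIdeal p,
    fg.1.eval (algebraMap K (RatFunc₂ K)) varX - fg.2.eval (algebraMap K (RatFunc₂ K)) varY = r + s}

/-- `s ∈ K ∪ {∞}` is a pole of the univariate rational function `f`: a root of its reduced
denominator if `s` is finite; if `s = ∞`, the degree of the numerator exceeds the degree of the
denominator. -/
def IsPoleUniv (f : RatFunc K) : OnePoint K → Prop
  | ∞ => f.denom.natDegree < f.num.natDegree
  | (a : K) => f.denom.IsRoot a

/-! ### The curve in `ℙ¹(K) × ℙ¹(K)` and its orbits -/

/-- The degree of `p` in `x`. (The degree in `y` is `p.natDegree`.) -/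
def degX (p : K[X][Y]) : ℕ := p.support.sup fun j => (p.coeff j).natDegree

/-- The value at `((x₀ : x₁), (y₀ : y₁))` of the bi-homogenization
`x₀ ^ deg_x p * y₀ ^ deg_y p * p (x₁ / x₀, y₁ / y₀)`. -/
def biHom (p : K[X][Y]) (x₀ x₁ y₀ y₁ : K) : K :=
  ∑ j ∈ Finset.range (p.natDegree + 1), ∑ i ∈ Finset.range (degX p + 1),
    (p.coeff j).coeff i * (x₀ ^ (degX p - i) * x₁ ^ i) * (y₀ ^ (p.natDegree - j) * y₁ ^ j)

/-- The homogeneous coordinate `x₀` of a point of `ℙ¹(K) = K ∪ {∞}`: `a = (1 : a)`,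
`∞ = (0 : 1)`. -/
def coord₀ : OnePoint K → K
  | ∞ => 0
  | (_ : K) => 1

/-- The homogeneous coordinate `x₁` of a point of `ℙ¹(K) = K ∪ {∞}`: `a = (1 : a)`,
`∞ = (0 : 1)`. -/
def coord₁ : OnePoint K → K
  | ∞ => 1
  | (a : K) => a

/-- The curve in `ℙ¹(K) × ℙ¹(K)` associated with the bi-homogenization of `p`. -/
def curve (p : K[X][Y]) : Set (OnePoint K × OnePoint K) :=
  {s | biHom p (coord₀ s.1) (coord₁ s.1) (coord₀ s.2) (coord₁ s.2) = 0}

/-- The orbit of a point of the curve: its class for the smallest equivalence relation on the curve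
for which points sharing their first or their second coordinate are equivalent. -/
def orbit (p : K[X][Y]) (s : curve p) : Set (curve p) :=
  {t | Relation.EqvGen (fun a b : curve p => a.1.1 = b.1.1 ∨ a.1.2 = b.1.2) s t}

/-! ### Poles on the curve, through Puiseux series -/

/-- A Hahn series with rational exponents is a Puiseux series if its exponents have a common
denominator. -/
def IsPuiseux (φ : HahnSeries ℚ K) : Prop :=
  ∃ n : ℕ, 0 < n ∧ ∀ α ∈ φ.support, ∃ k : ℤ, α = k / n

/-- For a series in the variable `x⁻¹`: its degree in `x`, that is, minus its order in `x⁻¹`,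
is positive (the degree of `0` being `-∞`). -/
def PosDegree (φ : HahnSeries ℚ K) : Prop := φ.orderTop < 0

/-- The element `x` of the field of series in `x⁻¹`. -/
def serX : HahnSeries ℚ K := HahnSeries.single (-1) 1

/-- `(∞, ∞)` is a pole of `r` on the curve of `p`: there is a Puiseux series `φ` in `x⁻¹` with
`p(x, φ) = 0`, `deg φ > 0` and `deg r(x, φ) > 0`. -/
def IsPoleAtInfty (p : K[X][Y]) (r : RatFunc₂ K) : Prop :=
  ∃ φ : HahnSeries ℚ K, IsPuiseux φ ∧ aevalAeval serX φ p = 0 ∧ PosDegree φ ∧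
    PosDegree (evalRat serX φ r)

/-- The Möbius transform `(a u + b) / (c u + d)` of an element `u` of a field extension of `K`. -/
def moebius {L : Type*} [Field L] [Algebra K L] (A : GL (Fin 2) K) (u : L) : L :=
  (algebraMap K L (A 0 0) * u + algebraMap K L (A 0 1)) /
    (algebraMap K L (A 1 0) * u + algebraMap K L (A 1 1))

/-- The rational function `r ∘ T` for the transformation `T : (x, y) ↦ (A x, B y)`. -/
def compT (r : RatFunc₂ K) (A B : GL (Fin 2) K) : RatFunc₂ K :=
  evalRat (moebius A varX) (moebius B varY) r

open Classical in
/-- The point `s` of the curve of `p` is a pole of `r`: some transformation `T = (A, B)` of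
`ℙ¹(K) × ℙ¹(K)` maps `s` to `(∞, ∞)`, and the latter is a pole of `r ∘ T⁻¹` on the curve of the
numerator of `p ∘ T⁻¹`. -/
def IsPole (p : K[X][Y]) (r : RatFunc₂ K) (s : curve p) : Prop :=
  ∃ A B : GL (Fin 2) K, A • s.1.1 = ∞ ∧ B • s.1.2 = ∞ ∧
    IsPoleAtInfty (numer (compT (ofPoly p) A⁻¹ B⁻¹)) (compT r A⁻¹ B⁻¹)

end SepVar

end

/-
A branch of the curve at a point `t` is a Puiseux series `φ` of positive degree for which the
local coordinates `u` of `x⁻¹` and `v` of `φ` at `t` satisfy `p(u, v) = 0`; Newton's theorem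
provides one at every point. The relation `f - g ∈ r + ⟨p⟩` then reads `f(u) - g(v) = r(u, v)`.
If `t` is not a pole of `r`, the right side is not large, so `f` has a pole at `t₁` exactly if
`g` has one at `t₂`. Were both coordinates of every pole of `r` in the orbit poles of `f` and of
`g`, this equivalence would hold on the whole orbit, and being a pole would spread from `s` to the
entire orbit. But `f` and `g` have only finitely many poles.
-/

noncomputable section

namespace SepVar

section Weierstrass

open IsLocalRing

theorem order_coe_eq_natTrailingDegree {R : Type*} [Semiring R] {f : R[X]} (hf : f ≠ 0) :
    (f : PowerSeries R).order = f.natTrailingDegree := by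
  refine PowerSeries.order_eq_nat.2 ⟨?_, fun i hi => ?_⟩
  · rwa [coeff_coe, Ne, coeff_natTrailingDegree_eq_zero]
  · rw [coeff_coe, coeff_eq_zero_of_lt_natTrailingDegree hi]

variable {A : Type*} [CommRing A] [IsLocalRing A] [IsAdicComplete (maximalIdeal A) A]

/- The Weierstrass polynomial of `g` divides `g` as a power series, hence as a polynomial because
`A[X] / P ≃ A⟦X⟧ / P`. -/
theorem exists_monic_dvd_natDegree_eq_natTrailingDegree {g : A[X]} (hg : g.map (residue A) ≠ 0) :
    ∃ P : A[X], P.Monic ∧ P ∣ g ∧ P.natDegree = (g.map (residue A)).natTrailingDegree := by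
  have hg' : (g : PowerSeries A).map (residue A) ≠ 0 := by
    rwa [← polynomial_map_coe, Ne, coe_eq_zero_iff]
  obtain ⟨P, h, hP⟩ := PowerSeries.exists_isWeierstrassFactorization hg'
  refine ⟨P, hP.isDistinguishedAt.monic, ?_, ?_⟩
  · have hdvd : (P : PowerSeries A) ∣ g := ⟨h, hP.eq_mul⟩
    rw [← Ideal.mem_span_singleton, ← Ideal.Quotient.eq_zero_iff_mem] at hdvd ⊢
    exact hP.isDistinguishedAt.algEquivQuotient.injective (hdvd.trans (map_zero _).symm)
  · rw [hP.natDegree_eq_toNat_order_map, ← polynomial_map_coe, order_coe_eq_natTrailingDegree hg,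
      ENat.toNat_natCast]

theorem exists_monic_dvd_natDegree_eq_rootMultiplicity {k : Type*} [Field k] (ρ : A →+* k)
    [IsLocalHom ρ] {g : A[X]} (hg : g.map ρ ≠ 0) (a : A) :
    ∃ P : A[X], P.Monic ∧ P ∣ g ∧ P.natDegree = (g.map ρ).rootMultiplicity (ρ a) := by
  have hmap :
      ((taylor a g).map (residue A)).map (ResidueField.lift ρ) = taylor (ρ a) (g.map ρ) := by
    rw [Polynomial.map_map, ResidueField.lift_comp_residue, map_taylor]
  have hmult : (g.map ρ).rootMultiplicity (ρ a) =
      ((taylor a g).map (residue A)).natTrailingDegree := by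
    rw [rootMultiplicity_eq_natTrailingDegree, ← taylor_apply, ← hmap,
      ← rootMultiplicity_eq_natTrailingDegree', ← rootMultiplicity_eq_natTrailingDegree',
      eq_rootMultiplicity_map (ResidueField.lift ρ).injective, map_zero]
  have hne : (taylor a g).map (residue A) ≠ 0 := fun h0 =>
    hg ((taylor_eq_zero _ _).1 (by rw [← hmap, h0, Polynomial.map_zero]))
  obtain ⟨P, hPm, ⟨q, hq⟩, hPdeg⟩ := exists_monic_dvd_natDegree_eq_natTrailingDegree hne
  refine ⟨taylor (-a) P, ?_, ⟨taylor (-a) q, ?_⟩, ?_⟩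
  · rw [Monic, leadingCoeff_taylor, hPm.leadingCoeff]
  · rw [← taylor_mul, ← hq, taylor_taylor, neg_add_cancel, taylor_zero]
  · rw [natDegree_taylor, hPdeg, hmult]

end Weierstrass

section Supported

variable {Γ K : Type*} [AddCommGroup Γ] [LinearOrder Γ] [IsOrderedAddMonoid Γ] [Field K]

/-- The subring of the Hahn series whose exponents all lie in the subgroup `H`. -/
def supportedIn (K : Type*) [Field K] (H : AddSubgroup Γ) : Subring (HahnSeries Γ K) where
  carrier := {x | x.support ⊆ H}
  zero_mem' := by simp
  one_mem' := HahnSeries.support_single_subset.trans (by simp)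
  add_mem' hx hy := (HahnSeries.support_add_subset _ _).trans (Set.union_subset hx hy)
  neg_mem' hx := by simpa using hx
  mul_mem' hx hy := HahnSeries.support_mul_subset.trans
    (Set.add_subset_iff.2 fun _ ha _ hb => H.add_mem (hx ha) (hy hb))

theorem mem_supportedIn {H : AddSubgroup Γ} {x : HahnSeries Γ K} :
    x ∈ supportedIn K H ↔ x.support ⊆ H := Iff.rfl

theorem supportedIn_mono {H H' : AddSubgroup Γ} (h : H ≤ H') :
    supportedIn K H ≤ supportedIn K H' := fun _ hx => Set.Subset.trans hx h

theorem single_mem_supportedIn {H : AddSubgroup Γ} {γ : Γ} (hγ : γ ∈ H) (a : K) :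
    HahnSeries.single γ a ∈ supportedIn K H :=
  HahnSeries.support_single_subset.trans (Set.singleton_subset_iff.2 hγ)

/- Split `x⁻¹ = y + z` with the exponents of `y` in `H` and those of `z` outside `H`. Then the
exponents of `x * z = 1 - x * y` lie both outside and inside `H`, so `z = 0`. -/
theorem inv_mem_supportedIn {H : AddSubgroup Γ} {x : HahnSeries Γ K} (hx : x ∈ supportedIn K H) :
    x⁻¹ ∈ supportedIn K H := by
  rcases eq_or_ne x 0 with rfl | hx0
  · rwa [inv_zero]
  let restrict (s : Set Γ) : HahnSeries Γ K :=
    ⟨s.indicator x⁻¹.coeff, x⁻¹.isPWO_support.mono (Set.support_indicator.trans_subset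
      Set.inter_subset_right)⟩
  have hsupp (s : Set Γ) : (restrict s).support ⊆ s := Set.support_indicator_subset
  have hadd : restrict H + restrict Hᶜ = x⁻¹ := by
    ext γ
    exact congrFun (Set.indicator_self_add_compl _ _) γ
  have hmem : x * restrict Hᶜ ∈ supportedIn K H := by
    rw [show x * restrict Hᶜ = 1 - x * restrict H by
      rw [eq_sub_iff_add_eq', ← mul_add, hadd, mul_inv_cancel₀ hx0]]
    exact sub_mem (one_mem _) (mul_mem hx (hsupp H))
  have hnotMem : (x * restrict Hᶜ).support ⊆ (H : Set Γ)ᶜ :=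
    HahnSeries.support_mul_subset.trans (Set.add_subset_iff.2 fun a ha b hb hab =>
      hsupp _ hb ((H.add_mem_cancel_left (hx ha)).1 hab))
  have hzero : restrict Hᶜ = 0 := by
    refine (mul_eq_zero.1 (HahnSeries.support_eq_empty_iff.1 ?_)).resolve_left hx0
    exact Set.subset_empty_iff.1 fun γ hγ => hnotMem hγ (hmem hγ)
  rw [← hadd, hzero, add_zero]
  exact hsupp H

end Supported

section Puiseux

variable {K : Type*} [Field K]

/-- The ring `K((t ^ (1 / N)))` of the series whose exponents are multiples of `1 / N`. -/
def laurentRoot (K : Type*) [Field K] (N : ℕ+) : Subring (HahnSeries ℚ K) :=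
  supportedIn K (AddSubgroup.zmultiples (N : ℚ)⁻¹)

theorem isPuiseux_iff_exists_mem_laurentRoot {φ : HahnSeries ℚ K} :
    IsPuiseux φ ↔ ∃ N : ℕ+, φ ∈ laurentRoot K N := by
  simp only [IsPuiseux, laurentRoot, mem_supportedIn, Set.subset_def, SetLike.mem_coe,
    AddSubgroup.mem_zmultiples_iff, zsmul_eq_mul, ← div_eq_mul_inv, eq_comm]
  exact ⟨fun ⟨n, hn, h⟩ => ⟨⟨n, hn⟩, h⟩, fun ⟨N, h⟩ => ⟨N, N.pos, h⟩⟩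

theorem laurentRoot_le_of_dvd {M N : ℕ+} (h : M ∣ N) : laurentRoot K M ≤ laurentRoot K N := by
  obtain ⟨k, rfl⟩ := h
  refine supportedIn_mono (AddSubgroup.zmultiples_le.2 (AddSubgroup.mem_zmultiples_iff.2 ⟨k, ?_⟩))
  push_cast
  rw [zsmul_eq_mul, mul_inv, Int.cast_natCast, mul_left_comm, mul_inv_cancel₀ (by positivity),
    mul_one]

theorem exists_forall_mem_laurentRoot {ι : Type*} (s : Finset ι) {x : ι → HahnSeries ℚ K}
    (hx : ∀ i ∈ s, IsPuiseux (x i)) : ∃ N : ℕ+, ∀ i ∈ s, x i ∈ laurentRoot K N := by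
  choose! n hn using fun i hi => isPuiseux_iff_exists_mem_laurentRoot.1 (hx i hi)
  exact ⟨∏ i ∈ s, n i, fun i hi => laurentRoot_le_of_dvd (Finset.dvd_prod_of_mem n hi) (hn i hi)⟩

theorem exists_mem_laurentRoot_and_mem {φ ψ : HahnSeries ℚ K} (hφ : IsPuiseux φ)
    (hψ : IsPuiseux ψ) : ∃ N : ℕ+, φ ∈ laurentRoot K N ∧ ψ ∈ laurentRoot K N := by
  obtain ⟨N, hN⟩ := exists_forall_mem_laurentRoot Finset.univ (x := fun b : Bool => cond b φ ψ)
    (by simp [hφ, hψ])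
  exact ⟨N, hN true (Finset.mem_univ _), hN false (Finset.mem_univ _)⟩

theorem algebraMap_hahnSeries (a : K) :
    algebraMap K (HahnSeries ℚ K) a = HahnSeries.single 0 a := by
  rw [HahnSeries.algebraMap_apply']
  exact HahnSeries.ofPowerSeries_C a

/-- The field of Puiseux series, as a subfield of the Hahn series with rational exponents. -/
def puiseux (K : Type*) [Field K] : IntermediateField K (HahnSeries ℚ K) where
  carrier := {φ | IsPuiseux φ}
  add_mem' hφ hψ := by
    obtain ⟨N, hφ, hψ⟩ := exists_mem_laurentRoot_and_mem hφ hψ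
    exact isPuiseux_iff_exists_mem_laurentRoot.2 ⟨N, add_mem hφ hψ⟩
  mul_mem' hφ hψ := by
    obtain ⟨N, hφ, hψ⟩ := exists_mem_laurentRoot_and_mem hφ hψ
    exact isPuiseux_iff_exists_mem_laurentRoot.2 ⟨N, mul_mem hφ hψ⟩
  algebraMap_mem' a := isPuiseux_iff_exists_mem_laurentRoot.2 ⟨1, by
    rw [algebraMap_hahnSeries]
    exact single_mem_supportedIn (zero_mem _) a⟩
  inv_mem' φ hφ := by
    obtain ⟨N, hφ⟩ := isPuiseux_iff_exists_mem_laurentRoot.1 hφ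
    exact isPuiseux_iff_exists_mem_laurentRoot.2 ⟨N, inv_mem_supportedIn hφ⟩

theorem isPuiseux_single (q : ℚ) (a : K) : IsPuiseux (HahnSeries.single q a) := by
  refine isPuiseux_iff_exists_mem_laurentRoot.2 ⟨⟨q.den, q.pos⟩, single_mem_supportedIn ?_ a⟩
  refine AddSubgroup.mem_zmultiples_iff.2 ⟨q.num, ?_⟩
  rw [zsmul_eq_mul, ← div_eq_mul_inv]
  exact q.num_div_den

/-- The embedding `X ↦ t ^ (1 / N)` of the power series into the Hahn series with rational
exponents. -/
def powerSeriesRoot (K : Type*) [Field K] (N : ℕ+) : PowerSeries K →+* HahnSeries ℚ K :=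
  (HahnSeries.embDomainRingHom ((AddMonoidHom.mulRight (N : ℚ)⁻¹).comp (Nat.castAddMonoidHom ℚ))
    (fun _ _ h => Nat.cast_injective (mul_right_cancel₀ (by positivity) h))
    (fun _ _ => (mul_le_mul_iff_left₀ (by positivity)).trans Nat.cast_le)).comp
  HahnSeries.toPowerSeries.symm.toRingHom

theorem coeff_powerSeriesRoot (N : ℕ+) (F : PowerSeries K) (n : ℕ) :
    (powerSeriesRoot K N F).coeff (n * (N : ℚ)⁻¹) = PowerSeries.coeff n F :=
  HahnSeries.embDomain_coeff
    (f := ⟨⟨(AddMonoidHom.mulRight (N : ℚ)⁻¹).comp (Nat.castAddMonoidHom ℚ), _⟩, _⟩)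

theorem support_powerSeriesRoot_subset (N : ℕ+) (F : PowerSeries K) :
    (powerSeriesRoot K N F).support ⊆ Set.range fun n : ℕ => (n : ℚ) * (N : ℚ)⁻¹ :=
  (HahnSeries.support_embDomain_subset (f :=
    ⟨⟨(AddMonoidHom.mulRight (N : ℚ)⁻¹).comp (Nat.castAddMonoidHom ℚ), _⟩, _⟩)).trans
    (Set.image_subset_range _ _)

theorem isPuiseux_powerSeriesRoot (N : ℕ+) (F : PowerSeries K) :
    IsPuiseux (powerSeriesRoot K N F) := by
  refine ⟨N, N.pos, fun q hq => ?_⟩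
  obtain ⟨n, rfl⟩ := support_powerSeriesRoot_subset N F hq
  exact ⟨n, (div_eq_mul_inv _ _).symm⟩

theorem coeff_zero_powerSeriesRoot (N : ℕ+) (F : PowerSeries K) :
    (powerSeriesRoot K N F).coeff 0 = PowerSeries.constantCoeff F := by
  simpa using coeff_powerSeriesRoot N F 0

theorem exists_powerSeriesRoot_eq {N : ℕ+} {x : HahnSeries ℚ K} (hx : x ∈ laurentRoot K N)
    (hx0 : 0 ≤ x.orderTop) : ∃ F, powerSeriesRoot K N F = x := by
  refine ⟨PowerSeries.mk fun n => x.coeff (n * (N : ℚ)⁻¹), ?_⟩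
  ext q
  by_cases hq : q ∈ Set.range fun n : ℕ => (n : ℚ) * (N : ℚ)⁻¹
  · obtain ⟨n, rfl⟩ := hq
    rw [coeff_powerSeriesRoot, PowerSeries.coeff_mk]
  · have hqx : q ∉ x.support := fun hqx => by
      obtain ⟨k, rfl⟩ := AddSubgroup.mem_zmultiples_iff.1 (hx hqx)
      have hk : (0 : ℚ) ≤ k • (N : ℚ)⁻¹ :=
        WithTop.coe_le_coe.1 (hx0.trans (HahnSeries.orderTop_le_of_coeff_ne_zero hqx))
      rw [zsmul_eq_mul, mul_nonneg_iff_of_pos_right (by positivity)] at hk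
      lift k to ℕ using mod_cast hk
      exact hq ⟨k, by simp⟩
    rw [Function.notMem_support.1 hqx,
      Function.notMem_support.1 fun h => hq (support_powerSeriesRoot_subset N _ h)]

/-- The embedding `X ↦ t ^ (1 / N)` of the power series into the Puiseux series. -/
def toPuiseux (K : Type*) [Field K] (N : ℕ+) : PowerSeries K →+* puiseux K :=
  (powerSeriesRoot K N).codRestrict (puiseux K) (isPuiseux_powerSeriesRoot N)

theorem exists_monic_map_toPuiseux_eq {f : (puiseux K)[X]} (hf : f.Monic)
    (hint : ∀ i, 0 ≤ (f.coeff i : HahnSeries ℚ K).orderTop) :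
    ∃ (N : ℕ+) (F : (PowerSeries K)[X]), F.Monic ∧ F.map (toPuiseux K N) = f := by
  obtain ⟨N, hN⟩ := exists_forall_mem_laurentRoot f.support
    (x := fun i => (f.coeff i : HahnSeries ℚ K)) (fun i _ => (f.coeff i).2)
  have hlifts : f ∈ lifts (toPuiseux K N) := by
    refine (lifts_iff_coeff_lifts _).2 fun i => ?_
    by_cases hi : i ∈ f.support
    · obtain ⟨F, hF⟩ := exists_powerSeriesRoot_eq (hN i hi) (hint i)
      exact ⟨F, Subtype.ext hF⟩
    · exact ⟨0, by rw [map_zero, notMem_support_iff.1 hi]⟩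
  obtain ⟨F, hFmap, -, hF⟩ := lifts_and_natDegree_eq_and_monic hlifts hf
  exact ⟨N, F, hF, hFmap⟩

end Puiseux

section NewtonPuiseux

theorem coeff_coeff_scaleRoots_single {Γ K : Type*} [AddCommGroup Γ] [LinearOrder Γ]
    [IsOrderedAddMonoid Γ] [CommRing K] (f : (HahnSeries Γ K)[X]) (α γ : Γ) (i : ℕ) :
    ((f.scaleRoots (HahnSeries.single (-α) 1)).coeff i).coeff γ =
      (f.coeff i).coeff (γ + (f.natDegree - i) • α) := by
  rw [coeff_scaleRoots, HahnSeries.single_pow, one_pow, HahnSeries.coeff_mul_single, mul_one,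
    smul_neg, sub_neg_eq_add]

/- `α` is the smallest slope of the Newton polygon of `f`. -/
theorem exists_scaleRoots_integral {K : Type*} [Field K] {f : (HahnSeries ℚ K)[X]} (hf : f.Monic)
    (hX : f ≠ X ^ f.natDegree) :
    ∃ α : ℚ, (∀ i, 0 ≤ ((f.scaleRoots (HahnSeries.single (-α) 1)).coeff i).orderTop) ∧
      ∃ i < f.natDegree, ((f.scaleRoots (HahnSeries.single (-α) 1)).coeff i).coeff 0 ≠ 0 := by
  classical
  set n := f.natDegree with hn
  have hne : (f.support.erase n).Nonempty := by
    rw [Finset.nonempty_iff_ne_empty]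
    refine fun he => hX (ext fun i => ?_)
    rw [coeff_X_pow]
    split_ifs with hi
    · rw [hi, hn, hf.coeff_natDegree]
    · by_contra hc
      exact Finset.notMem_empty i (he ▸ Finset.mem_erase.2 ⟨hi, mem_support_iff.2 hc⟩)
  have hlt {i : ℕ} (hi : i ∈ f.support.erase n) : i < n :=
    (le_natDegree_of_mem_supp i (Finset.mem_of_mem_erase hi)).lt_of_ne (Finset.ne_of_mem_erase hi)
  obtain ⟨i₀, hi₀, hmin⟩ := Finset.exists_min_image _
    (fun i => (f.coeff i).order / ((n - i : ℕ) : ℚ)) hne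
  have hpos {i : ℕ} (hi : i < n) : (0 : ℚ) < (n - i : ℕ) := by exact_mod_cast Nat.sub_pos_of_lt hi
  refine ⟨(f.coeff i₀).order / ((n - i₀ : ℕ) : ℚ), fun i => ?_, i₀, hlt hi₀, ?_⟩
  · refine HahnSeries.le_orderTop_iff_forall.2 fun q hq => ?_
    rw [coeff_coeff_scaleRoots_single, ← hn]
    have hq : q < 0 := by exact_mod_cast hq
    by_cases hi : i ∈ f.support.erase n
    · refine HahnSeries.coeff_eq_zero_of_lt_order ?_
      have := (le_div_iff₀' (hpos (hlt hi))).1 (hmin i hi)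
      rw [nsmul_eq_mul]
      linarith
    · rcases eq_or_ne i n with rfl | hin
      · rw [hn, hf.coeff_natDegree, Nat.sub_self, zero_smul, add_zero, HahnSeries.coeff_one,
          if_neg hq.ne]
      · rw [notMem_support_iff.1 fun h => hi (Finset.mem_erase.2 ⟨hin, h⟩), HahnSeries.coeff_zero]
  · rw [coeff_coeff_scaleRoots_single, zero_add, ← hn, nsmul_eq_mul,
      mul_div_cancel₀ _ (hpos (hlt hi₀)).ne']
    exact HahnSeries.coeff_order_eq_zero.not.2 (mem_support_iff.1 (Finset.mem_of_mem_erase hi₀))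

/- If all roots were equal, their sum `0` would be a nonzero multiple of each. -/
theorem exists_rootMultiplicity_lt {K : Type*} [Field K] [IsAlgClosed K] [CharZero K] {f : K[X]}
    (hf : f.Monic) (hn : f.natDegree ≠ 0) (h0 : f.coeff (f.natDegree - 1) = 0)
    (hX : f ≠ X ^ f.natDegree) :
    ∃ c, 0 < f.rootMultiplicity c ∧ f.rootMultiplicity c < f.natDegree := by
  obtain ⟨c, hc⟩ := IsAlgClosed.exists_root f (fun h => hn (natDegree_eq_of_degree_eq_some h))
  refine ⟨c, (rootMultiplicity_pos hf.ne_zero).2 hc, lt_of_not_ge fun hle => hX ?_⟩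
  have hpow : f = (X - C c) ^ f.natDegree :=
    eq_of_monic_of_dvd_of_natDegree_le ((monic_X_sub_C c).pow _) hf
      ((le_rootMultiplicity_iff hf.ne_zero).1 hle)
      (by rw [natDegree_pow, natDegree_X_sub_C, mul_one])
  have hnext : f.nextCoeff = f.natDegree • -c := by
    conv_lhs => rw [hpow]
    rw [(monic_X_sub_C c).nextCoeff_pow, nextCoeff_X_sub_C]
  rw [nextCoeff_of_natDegree_pos (Nat.pos_of_ne_zero hn), h0, smul_neg, zero_eq_neg,
    smul_eq_zero_iff_right hn] at hnext
  rwa [hnext, C_0, sub_zero] at hpow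

instance isAdicComplete_powerSeries {K : Type*} [Field K] :
    IsAdicComplete (IsLocalRing.maximalIdeal (PowerSeries K)) (PowerSeries K) := by
  rw [PowerSeries.maximalIdeal_eq_span_X]
  infer_instance

variable {K : Type*} [Field K]

instance isLocalHom_constantCoeff : IsLocalHom (PowerSeries.constantCoeff (R := K)) :=
  ⟨fun _ => PowerSeries.isUnit_iff_constantCoeff.2⟩

instance charZero_puiseux [CharZero K] : CharZero (puiseux K) :=
  charZero_of_injective_algebraMap (algebraMap K _).injective

theorem exists_monic_dvd_of_powerSeries [IsAlgClosed K] [CharZero K] {F : (PowerSeries K)[X]}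
    (hF : F.Monic) (hn : F.natDegree ≠ 0)
    (h0 : PowerSeries.constantCoeff (F.coeff (F.natDegree - 1)) = 0)
    (hX : F.map PowerSeries.constantCoeff ≠ X ^ F.natDegree) :
    ∃ P : (PowerSeries K)[X], P.Monic ∧ P ∣ F ∧ 0 < P.natDegree ∧ P.natDegree < F.natDegree := by
  have hdeg := hF.natDegree_map (PowerSeries.constantCoeff (R := K))
  obtain ⟨c, hpos, hlt⟩ := exists_rootMultiplicity_lt (hF.map PowerSeries.constantCoeff)
    (by rwa [hdeg]) (by rwa [coeff_map, hdeg]) (by rwa [hdeg])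
  obtain ⟨P, hP, hdvd, hPdeg⟩ := exists_monic_dvd_natDegree_eq_rootMultiplicity
    PowerSeries.constantCoeff (hF.map _).ne_zero (PowerSeries.C c)
  rw [PowerSeries.constantCoeff_C] at hPdeg
  exact ⟨P, hP, hdvd, hPdeg ▸ hpos, hPdeg ▸ hdeg ▸ hlt⟩

theorem natDegree_eq_of_dvd_scaleRoots {L : Type*} [Field L] {f q : L[X]} (hf : Irreducible f)
    {s : L} (hs : s ≠ 0) (hq : q ∣ f.scaleRoots s) (hq0 : q.natDegree ≠ 0) :
    q.natDegree = f.natDegree := by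
  have hdvd : q.scaleRoots s⁻¹ ∣ f := by
    simpa only [← scaleRoots_mul, mul_inv_cancel₀ hs, scaleRoots_one] using
      scaleRoots_dvd (r := s⁻¹) q _ hq
  obtain ⟨g, hg⟩ := hdvd
  have hgu : IsUnit g := (hf.isUnit_or_isUnit hg).resolve_left fun hu =>
    hq0 (by rw [← natDegree_scaleRoots q s⁻¹, natDegree_eq_zero_of_isUnit hu])
  rw [hg, natDegree_mul (left_ne_zero_of_mul (hg ▸ hf.ne_zero)) hgu.ne_zero,
    natDegree_eq_zero_of_isUnit hgu, natDegree_scaleRoots, add_zero]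

theorem eq_X_pow_of_irreducible [IsAlgClosed K] [CharZero K] {f : (puiseux K)[X]} (hf : f.Monic)
    (hirr : Irreducible f) (h0 : f.coeff (f.natDegree - 1) = 0) : f = X ^ f.natDegree := by
  by_contra hX
  set ι := algebraMap (puiseux K) (HahnSeries ℚ K)
  have hdeg : (f.map ι).natDegree = f.natDegree := natDegree_map _
  obtain ⟨α, hint, i, hi, hne⟩ := exists_scaleRoots_integral (hf.map ι) (by
    rw [hdeg, ← Polynomial.map_X (f := ι), ← Polynomial.map_pow]
    exact (map_injective ι ι.injective).ne hX)
  set s : puiseux K := ⟨HahnSeries.single (-α) 1, isPuiseux_single _ 1⟩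
  have hs0 : s ≠ 0 := fun h => HahnSeries.single_ne_zero one_ne_zero (congrArg Subtype.val h)
  have hscale : (f.map ι).scaleRoots (HahnSeries.single (-α) 1) = (f.scaleRoots s).map ι :=
    (map_scaleRoots f s ι (by simp [hf.leadingCoeff])).symm
  simp only [hscale, coeff_map] at hint hne
  obtain ⟨N, F, hF, hFmap⟩ :=
    exists_monic_map_toPuiseux_eq ((monic_scaleRoots_iff s).2 hf) hint
  have hFdeg : F.natDegree = f.natDegree := by
    rw [← hF.natDegree_map (toPuiseux K N), hFmap, natDegree_scaleRoots]
  have hres (j : ℕ) : PowerSeries.constantCoeff (F.coeff j) =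
      ((f.scaleRoots s).coeff j : HahnSeries ℚ K).coeff 0 := by
    rw [← hFmap, coeff_map]
    exact (coeff_zero_powerSeriesRoot N _).symm
  have hF0 : PowerSeries.constantCoeff (F.coeff (F.natDegree - 1)) = 0 := by
    rw [hres, hFdeg, coeff_scaleRoots, h0, zero_mul]
    rfl
  have hFX : F.map PowerSeries.constantCoeff ≠ X ^ F.natDegree := fun h => hne <| by
    refine (hres i).symm.trans ?_
    rw [← coeff_map, h, coeff_X_pow, if_neg (hFdeg ▸ hdeg ▸ hi.ne)]
  obtain ⟨P, hP, hdvd, hpos, hlt⟩ :=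
    exists_monic_dvd_of_powerSeries hF (hFdeg ▸ hirr.natDegree_pos.ne') hF0 hFX
  rw [← hP.natDegree_map (toPuiseux K N)] at hpos hlt
  exact hlt.ne ((natDegree_eq_of_dvd_scaleRoots hirr hs0
    (hFmap ▸ Polynomial.map_dvd (toPuiseux K N) hdvd) hpos.ne').trans hFdeg.symm)

theorem exists_taylor_coeff_eq_zero {L : Type*} [Field L] [CharZero L] {f : L[X]} (hf : f.Monic)
    (hn : f.natDegree ≠ 0) : ∃ c, (taylor c f).coeff (f.natDegree - 1) = 0 := by
  have hn' : (f.natDegree : L) ≠ 0 := Nat.cast_ne_zero.2 hn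
  refine ⟨-(f.coeff (f.natDegree - 1)) / f.natDegree, ?_⟩
  have hdeg : (hasseDeriv (f.natDegree - 1) f).natDegree < 2 := by
    have := natDegree_hasseDeriv_le f (f.natDegree - 1)
    omega
  rw [taylor_coeff, eval_eq_sum_range' hdeg, Finset.sum_range_succ, Finset.sum_range_one,
    hasseDeriv_coeff, hasseDeriv_coeff, zero_add, Nat.choose_self, add_comm 1,
    Nat.sub_add_cancel (Nat.pos_of_ne_zero hn), hf.coeff_natDegree,
    Nat.choose_symm (Nat.pos_of_ne_zero hn), Nat.choose_one_right]
  push_cast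
  field_simp
  ring

instance isAlgClosed_puiseux [IsAlgClosed K] [CharZero K] : IsAlgClosed (puiseux K) := by
  refine IsAlgClosed.of_exists_root _ fun f hf hirr => ?_
  obtain ⟨c, hc⟩ := exists_taylor_coeff_eq_zero hf hirr.natDegree_pos.ne'
  have hX := eq_X_pow_of_irreducible (f := taylor c f)
    (by rw [Monic, leadingCoeff_taylor, hf.leadingCoeff])
    ((MulEquiv.irreducible_iff (taylorEquiv c)).2 hirr) (by rwa [natDegree_taylor])
  refine ⟨c, ?_⟩
  rw [← taylor_coeff_zero, hX, natDegree_taylor, coeff_X_pow, if_neg hirr.natDegree_pos.ne]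

end NewtonPuiseux

section Integers

variable {K : Type*} [Field K]

/-- The valuation ring of the field of series with rational exponents. -/
def integers (K : Type*) [Field K] : Subalgebra K (HahnSeries ℚ K) where
  carrier := {x | 0 ≤ x.orderTop}
  mul_mem' hx hy := by
    rw [Set.mem_ofPred_eq] at *
    exact (add_nonneg hx hy).trans_eq (HahnSeries.orderTop_mul _ _).symm
  add_mem' hx hy := by
    rw [Set.mem_ofPred_eq] at *
    exact (le_min hx hy).trans HahnSeries.min_orderTop_le_orderTop_add
  algebraMap_mem' a := by
    rw [Set.mem_ofPred_eq, algebraMap_hahnSeries]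
    exact HahnSeries.orderTop_single_le

theorem mem_integers {x : HahnSeries ℚ K} : x ∈ integers K ↔ 0 ≤ x.orderTop :=
  Iff.of_eq Set.mem_ofPred_eq

theorem posDegree_iff_notMem_integers {x : HahnSeries ℚ K} : PosDegree x ↔ x ∉ integers K := by
  rw [mem_integers, not_le, PosDegree]

theorem PosDegree.ne_zero {x : HahnSeries ℚ K} (hx : PosDegree x) : x ≠ 0 := by
  rintro rfl
  exact posDegree_iff_notMem_integers.1 hx (zero_mem _)

theorem PosDegree.orderTop_inv_pos {x : HahnSeries ℚ K} (hx : PosDegree x) :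
    0 < x⁻¹.orderTop := by
  by_contra! hle
  have h : x.orderTop + x⁻¹.orderTop = 0 := by
    rw [← HahnSeries.orderTop_mul, mul_inv_cancel₀ hx.ne_zero, HahnSeries.orderTop_one]
  exact (add_neg_of_neg_of_nonpos hx hle).ne h

theorem posDegree_serX : PosDegree (serX : HahnSeries ℚ K) := by
  rw [PosDegree, serX, HahnSeries.orderTop_single one_ne_zero]
  exact_mod_cast neg_one_lt_zero (R := ℚ)

theorem coeff_zero_mul {x y : HahnSeries ℚ K} (hx : x ∈ integers K) (hy : y ∈ integers K) :
    (x * y).coeff 0 = x.coeff 0 * y.coeff 0 := by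
  have hnonneg {z : HahnSeries ℚ K} (hz : z ∈ integers K) {q : ℚ} (hq : q ∈ z.support) : 0 ≤ q :=
    WithTop.coe_le_coe.1 ((mem_integers.1 hz).trans (HahnSeries.orderTop_le_of_coeff_ne_zero hq))
  rw [HahnSeries.coeff_mul, Finset.sum_eq_single (0, 0)]
  · rintro ⟨q, q'⟩ hqq' hne
    obtain ⟨hq, hq', hadd⟩ := Finset.mem_antidiagonal.1 hqq'
    exact absurd (Prod.ext_iff.2 ((add_eq_zero_iff_of_nonneg (hnonneg hx hq) (hnonneg hy hq')).1
      hadd)) hne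
  · intro h
    by_contra hne
    exact h (Finset.mem_antidiagonal.2
      ⟨left_ne_zero_of_mul hne, right_ne_zero_of_mul hne, add_zero 0⟩)

/-- The residue map of the valuation ring, which takes the constant coefficient. -/
def res (K : Type*) [Field K] : integers K →ₐ[K] K where
  toFun x := (x : HahnSeries ℚ K).coeff 0
  map_one' := by simp
  map_mul' x y := coeff_zero_mul x.2 y.2
  map_zero' := rfl
  map_add' _ _ := rfl
  commutes' a := by
    change (algebraMap K (HahnSeries ℚ K) a).coeff 0 = a
    rw [algebraMap_hahnSeries, HahnSeries.coeff_single_same]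

theorem res_eq_zero_iff {x : integers K} : res K x = 0 ↔ 0 < (x : HahnSeries ℚ K).orderTop :=
  ⟨fun h => (mem_integers.1 x.2).lt_of_ne' (HahnSeries.orderTop_ne_of_coeff_eq_zero h),
    HahnSeries.coeff_eq_zero_of_lt_orderTop⟩

theorem posDegree_div_iff {x y : integers K} (hy : (y : HahnSeries ℚ K) ≠ 0)
    (h : res K x ≠ 0 ∨ res K y ≠ 0) : PosDegree (x / y : HahnSeries ℚ K) ↔ res K y = 0 := by
  rw [posDegree_iff_notMem_integers]
  refine ⟨fun hdiv => ?_, fun hres hdiv => ?_⟩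
  · by_contra hres
    have hy0 : (y : HahnSeries ℚ K).orderTop = 0 :=
      (not_lt.1 (res_eq_zero_iff.not.1 hres)).antisymm (mem_integers.1 y.2)
    have hmul := HahnSeries.orderTop_mul (x / y : HahnSeries ℚ K) y
    rw [div_mul_cancel₀ _ hy, hy0, add_zero] at hmul
    exact hdiv (mem_integers.2 (hmul ▸ mem_integers.1 x.2))
  · have hx : x = (⟨(x : HahnSeries ℚ K) / (y : HahnSeries ℚ K), hdiv⟩ : integers K) * y :=
      Subtype.ext (div_mul_cancel₀ _ hy).symm
    refine h.elim (fun hx0 => hx0 ?_) (fun hy0 => hy0 hres)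
    rw [hx, map_mul, hres, mul_zero]

/- If `x` were algebraic over `K`, then it would lie in `K[x⁻¹]`, which consists of integers. -/
theorem PosDegree.transcendental {x : HahnSeries ℚ K} (hx : PosDegree x) : Transcendental K x := by
  intro halg
  have hinv := (integers K).inv_mem_of_algebraic
    (x := ⟨x⁻¹, mem_integers.2 hx.orderTop_inv_pos.le⟩) halg.inv
  rw [inv_inv] at hinv
  exact posDegree_iff_notMem_integers.1 hx hinv

end Integers

section Chart

variable {K : Type*} [Field K]

/-- A transformation of `ℙ¹(K)` that maps `∞` to the given point. Along a series `φ` of positive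
degree, `moebius (chart c) φ` is a local coordinate at `c`. -/
def chart : OnePoint K → GL (Fin 2) K
  | ∞ => 1
  | (a : K) => Matrix.GeneralLinearGroup.mkOfDetNeZero !![a, 1; 1, 0]
      (by simp [Matrix.det_fin_two_of])

theorem chart_smul_infty [DecidableEq K] (c : OnePoint K) : chart c • (∞ : OnePoint K) = c := by
  induction c using OnePoint.rec with
  | infty => exact one_smul _ _
  | coe a => simp [OnePoint.smul_infty_eq_ite, chart, Matrix.GeneralLinearGroup.mkOfDetNeZero]

section Moebius

variable {L : Type*} [Field L] [Algebra K L]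

theorem moebius_chart_infty (u : L) : moebius (chart (∞ : OnePoint K)) u = u := by
  simp [moebius, chart]

theorem moebius_chart_coe (a : K) {u : L} (hu : u ≠ 0) :
    moebius (chart (a : OnePoint K)) u = u⁻¹ + algebraMap K L a := by
  simp only [moebius, chart, Matrix.GeneralLinearGroup.mkOfDetNeZero]
  simp [Matrix.GeneralLinearGroup.mk', Matrix.unitOfDetInvertible]
  field_simp
  ring

theorem moebius_chart_mem_iff (F : IntermediateField K L) {u : L} (hu : u ≠ 0)
    (c : OnePoint K) : moebius (chart c) u ∈ F ↔ u ∈ F := by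
  induction c using OnePoint.rec with
  | infty => rw [moebius_chart_infty]
  | coe a => rw [moebius_chart_coe a hu, add_mem_cancel_right (F.algebraMap_mem a), inv_mem_iff]

end Moebius

theorem PosDegree.transcendental_moebius_chart {φ : HahnSeries ℚ K} (hφ : PosDegree φ)
    (c : OnePoint K) : Transcendental K (moebius (chart c) φ) := by
  rw [Transcendental, ← mem_algebraicClosure_iff, moebius_chart_mem_iff _ hφ.ne_zero,
    mem_algebraicClosure_iff]
  exact hφ.transcendental

/-- The value at a point of `ℙ¹(K)` of the homogenization of degree `N` of a polynomial. -/
def homEval (c : OnePoint K) (N : ℕ) (h : K[X]) : K :=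
  ∑ i ∈ Finset.range (N + 1), h.coeff i * (coord₀ c ^ (N - i) * coord₁ c ^ i)

theorem homEval_infty (N : ℕ) (h : K[X]) : homEval ∞ N h = h.coeff N := by
  rw [homEval, Finset.sum_range_succ, Finset.sum_eq_zero, zero_add]
  · simp [coord₀, coord₁]
  · intro i hi
    simp [coord₀, (Nat.sub_pos_of_lt (Finset.mem_range.1 hi)).ne']

theorem homEval_coe (a : K) {N : ℕ} {h : K[X]} (hN : h.natDegree ≤ N) :
    homEval (a : OnePoint K) N h = h.eval a := by
  rw [homEval, eval_eq_sum_range' (Nat.lt_succ_of_le hN)]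
  simp [coord₀, coord₁]

theorem res_aeval (w : integers K) (h : K[X]) : res K (aeval w h) = h.eval (res K w) := by
  rw [← aeval_algHom_apply, coe_aeval_eq_eval]

/- `s` is the common pole of order `N` of the polynomials of degree `N` when `c = ∞`. -/
theorem exists_aeval_moebius_chart_eq {φ : HahnSeries ℚ K} (hφ : PosDegree φ) (c : OnePoint K)
    (N : ℕ) : ∃ s : HahnSeries ℚ K, s ≠ 0 ∧ ∀ h : K[X], h.natDegree ≤ N →
      ∃ z : integers K, aeval (moebius (chart c) φ) h = s * z ∧ res K z = homEval c N h := by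
  set w : integers K := ⟨φ⁻¹, mem_integers.2 hφ.orderTop_inv_pos.le⟩
  have hw : res K w = 0 := res_eq_zero_iff.2 hφ.orderTop_inv_pos
  have hcoe (h : K[X]) : (aeval w h : HahnSeries ℚ K) = aeval φ⁻¹ h :=
    (aeval_algHom_apply (integers K).val w h).symm
  induction c using OnePoint.rec with
  | infty =>
    refine ⟨φ ^ N, pow_ne_zero _ hφ.ne_zero, fun h hh => ⟨aeval w (reflect N h), ?_, ?_⟩⟩
    · let _ := invertibleOfNonzero hφ.ne_zero
      rw [hcoe, moebius_chart_infty, aeval_def, aeval_def, mul_comm, ← invOf_eq_inv,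
        eval₂_reflect_mul_pow _ _ _ _ hh]
    · rw [res_aeval, hw, ← coeff_zero_eq_eval_zero, homEval_infty, coeff_reflect,
        revAt_le (Nat.zero_le _), Nat.sub_zero]
  | coe a =>
    refine ⟨1, one_ne_zero, fun h hh => ⟨aeval w (taylor a h), ?_, ?_⟩⟩
    · rw [hcoe, moebius_chart_coe a hφ.ne_zero, one_mul, taylor_apply, aeval_comp]
      simp only [map_add, aeval_X, aeval_C]
    · rw [res_aeval, hw, homEval_coe a hh, ← coeff_zero_eq_eval_zero, taylor_coeff_zero]

theorem homEval_num_ne_zero_or_denom_ne_zero (f : RatFunc K) (c : OnePoint K) :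
    homEval c (max f.num.natDegree f.denom.natDegree) f.num ≠ 0 ∨
      homEval c (max f.num.natDegree f.denom.natDegree) f.denom ≠ 0 := by
  induction c using OnePoint.rec with
  | infty =>
    rw [homEval_infty, homEval_infty]
    rcases le_or_gt f.num.natDegree f.denom.natDegree with h | h
    · rw [max_eq_right h]
      exact Or.inr (leadingCoeff_ne_zero.2 f.denom_ne_zero)
    · rw [max_eq_left h.le]
      exact Or.inl (leadingCoeff_ne_zero.2 (ne_zero_of_natDegree_gt h))
  | coe a =>
    rw [homEval_coe a (le_max_left _ _), homEval_coe a (le_max_right _ _)]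
    by_contra! hcon
    exact not_isUnit_X_sub_C a (f.isCoprime_num_denom.isUnit_of_dvd'
      (dvd_iff_isRoot.2 hcon.1) (dvd_iff_isRoot.2 hcon.2))

theorem isPoleUniv_iff_homEval_denom_eq_zero (f : RatFunc K) (c : OnePoint K) :
    IsPoleUniv f c ↔ homEval c (max f.num.natDegree f.denom.natDegree) f.denom = 0 := by
  induction c using OnePoint.rec with
  | infty =>
    rw [homEval_infty]
    change f.denom.natDegree < f.num.natDegree ↔ _
    rcases le_or_gt f.num.natDegree f.denom.natDegree with h | h
    · rw [max_eq_right h]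
      exact iff_of_false h.not_gt (leadingCoeff_ne_zero.2 f.denom_ne_zero)
    · rw [max_eq_left h.le]
      exact iff_of_true h (coeff_eq_zero_of_natDegree_lt h)
  | coe a =>
    rw [homEval_coe a (le_max_right _ _)]
    exact Iff.rfl

theorem isPoleUniv_iff_posDegree_eval {φ : HahnSeries ℚ K} (hφ : PosDegree φ) (c : OnePoint K)
    (f : RatFunc K) :
    IsPoleUniv f c ↔ PosDegree (f.eval (algebraMap K _) (moebius (chart c) φ)) := by
  obtain ⟨s, hs, h⟩ := exists_aeval_moebius_chart_eq hφ c (max f.num.natDegree f.denom.natDegree)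
  obtain ⟨n, hn, hn_res⟩ := h f.num (le_max_left _ _)
  obtain ⟨d, hd, hd_res⟩ := h f.denom (le_max_right _ _)
  have hd0 : (d : HahnSeries ℚ K) ≠ 0 := fun h0 => f.denom_ne_zero
    (transcendental_iff.1 (hφ.transcendental_moebius_chart c) _ (by rw [hd, h0, mul_zero]))
  rw [isPoleUniv_iff_homEval_denom_eq_zero, RatFunc.eval, ← aeval_def, ← aeval_def, hn, hd,
    mul_div_mul_left _ _ hs, posDegree_div_iff hd0, hd_res]
  rw [hn_res, hd_res]
  exact homEval_num_ne_zero_or_denom_ne_zero f c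

theorem finite_isPoleUniv (f : RatFunc K) : {c | IsPoleUniv f c}.Finite := by
  have hroots := finite_setOfPred_isRoot f.denom_ne_zero
  refine ((hroots.image ((↑) : K → OnePoint K)).insert ∞).subset fun c hc => ?_
  induction c using OnePoint.rec with
  | infty => exact Set.mem_insert _ _
  | coe a => exact Set.mem_insert_of_mem _ (Set.mem_image_of_mem _ hc)

end Chart

section RootsNearPoint

section Lifts

variable {R L : Type*} [CommRing R] [Field L] (i : R →+* L) {q : L[X]}

theorem map_eq_zero_of_C_inv_mul_mem_lifts {k : Type*} [CommRing k] (hi : Function.Injective i)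
    (ρ : R →+* k) {Q : R[X]} {v : R} (hv : i v ≠ 0) (h : C (i v)⁻¹ * Q.map i ∈ lifts i)
    (hρ : ρ v = 0) : Q.map ρ = 0 := by
  obtain ⟨G, hG⟩ := (mem_lifts _).1 h
  have hQ : Q.map i = (C v * G).map i := by
    rw [Polynomial.map_mul, map_C, hG, ← mul_assoc, ← C_mul, mul_inv_cancel₀ hv, C_1, one_mul]
  rw [map_injective i hi hQ, Polynomial.map_mul, map_C, hρ, C_0, zero_mul]

theorem C_inv_leadingCoeff_mul_mem_lifts (hq : q.Splits) (hq0 : q ≠ 0)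
    (h : ∀ a, q.IsRoot a → a ∈ i.range) : C q.leadingCoeff⁻¹ * q ∈ lifts i := by
  refine (hq.C_mul _).mem_lift_of_roots_mem_range
    (mul_comm q _ ▸ monic_mul_leadingCoeff_inv hq0) i fun a ha => h a ?_
  rw [roots_C_mul _ (inv_ne_zero (leadingCoeff_ne_zero.2 hq0))] at ha
  exact isRoot_of_mem_roots ha

theorem C_inv_eval_mul_eq_prod (hq : q.Splits) {b : L} (hb : q.eval b ≠ 0) :
    C (q.eval b)⁻¹ * q = (q.roots.map fun a => 1 - C (a - b)⁻¹ * (X - C b)).prod := by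
  have hfactor {a : L} (ha : a ∈ q.roots) :
      1 - C (a - b)⁻¹ * (X - C b) = C (b - a)⁻¹ * (X - C a) := by
    have hne : b - a ≠ 0 := sub_ne_zero.2 fun h => hb (h ▸ isRoot_of_mem_roots ha)
    rw [← neg_sub b a, inv_neg, ← C_1, ← inv_mul_cancel₀ hne, C_neg, C_mul, C_sub]
    ring
  have hinv : (q.roots.map fun a => C (b - a)⁻¹).prod = C (q.roots.map (b - ·)).prod⁻¹ := by
    rw [← Multiset.prod_map_inv, map_multiset_prod, Multiset.map_map]
    rfl
  have hq0 : q.leadingCoeff ≠ 0 := leadingCoeff_ne_zero.2 fun h => hb (by rw [h, eval_zero])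
  rw [Multiset.map_congr rfl fun a => hfactor, Multiset.prod_map_mul, hinv]
  nth_rw 2 [hq.eq_prod_roots]
  rw [hq.eval_eq_prod_roots, ← mul_assoc, ← C_mul, mul_inv_rev, inv_mul_cancel_right₀ hq0]

theorem C_inv_eval_mul_mem_lifts (hq : q.Splits) {b : L} (hb : b ∈ i.range) (hqb : q.eval b ≠ 0)
    (h : ∀ a, q.IsRoot a → (a - b)⁻¹ ∈ i.range) : C (q.eval b)⁻¹ * q ∈ lifts i := by
  rw [C_inv_eval_mul_eq_prod hq hqb, lifts_iff_liftsRing]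
  refine Subring.multiset_prod_mem _ _ fun g hg => ?_
  obtain ⟨a, ha, rfl⟩ := Multiset.mem_map.1 hg
  exact sub_mem (one_mem _) (mul_mem (C'_mem_lifts (h a (isRoot_of_mem_roots ha)))
    (sub_mem (X_mem_lifts i) (C'_mem_lifts hb)))

end Lifts

variable {K : Type*} [Field K] {Q : (integers K)[X]}

theorem mem_range_algebraMap_integers {x : HahnSeries ℚ K} (hx : ¬ PosDegree x) :
    x ∈ (algebraMap (integers K) (HahnSeries ℚ K)).range :=
  ⟨⟨x, not_not.1 (posDegree_iff_notMem_integers.not.1 hx)⟩, rfl⟩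

/- If no root is near `c`, dividing `Q` by its value at `c` keeps its coefficients integral. That
value has residue `0`, so the reduction of `Q` would vanish. -/
theorem exists_isRoot_moebius_chart (hs : (Q.map (algebraMap _ (HahnSeries ℚ K))).Splits)
    (hQ : Q.map (res K : integers K →+* K) ≠ 0) (c : OnePoint K)
    (hc : homEval c Q.natDegree (Q.map (res K : integers K →+* K)) = 0)
    (hroot : ∀ b : K,
      ¬ (Q.map (algebraMap _ (HahnSeries ℚ K))).IsRoot (algebraMap K (HahnSeries ℚ K) b)) :
    ∃ φ, PosDegree φ ∧
      (Q.map (algebraMap _ (HahnSeries ℚ K))).IsRoot (moebius (chart c) φ) := by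
  set ι := algebraMap (integers K) (HahnSeries ℚ K)
  have hι : Function.Injective ι := Subtype.val_injective
  by_contra! hcon
  induction c using OnePoint.rec with
  | infty =>
    simp only [moebius_chart_infty] at hcon
    rw [homEval_infty, coeff_map] at hc
    have hq0 : Q.map ι ≠ 0 := fun h => hQ (by
      rw [(Polynomial.map_eq_zero_iff hι).1 h, Polynomial.map_zero])
    have hlift := C_inv_leadingCoeff_mul_mem_lifts ι hs hq0 fun a ha =>
      mem_range_algebraMap_integers fun h => hcon a h ha
    have hlead := leadingCoeff_ne_zero.2 hq0
    rw [leadingCoeff_map_of_injective hι] at hlift hlead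
    exact hQ (map_eq_zero_of_C_inv_mul_mem_lifts ι hι _ hlead hlift hc)
  | coe b =>
    have hres : (res K : integers K →+* K) (algebraMap K _ b) = b := (res K).commutes b
    have hcoe : ι (algebraMap K _ b) = algebraMap K _ b := rfl
    rw [homEval_coe b natDegree_map_le, ← hres, eval_map_apply] at hc
    have hval := hroot b
    rw [← hcoe, IsRoot.def, eval_map_apply] at hval
    have hlift := C_inv_eval_mul_mem_lifts ι hs ⟨algebraMap K _ b, rfl⟩ (hroot b) fun a ha =>
      mem_range_algebraMap_integers fun h => hcon _ h <| by
        rwa [moebius_chart_coe b h.ne_zero, inv_inv, hcoe, sub_add_cancel]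
    rw [eval_map_apply] at hlift
    exact hQ (map_eq_zero_of_C_inv_mul_mem_lifts ι hι _ hval hlift hc)

end RootsNearPoint

section Branch

variable {K : Type*} [Field K]

section SpecX

variable {L L' : Type*} [CommRing L] [Algebra K L] [CommRing L'] [Algebra K L']

/-- The univariate polynomial `p(u, Y)`. -/
def specX (u : L) (p : K[X][Y]) : L[X] := p.map (aeval u : K[X] →ₐ[K] L)

theorem coeff_specX (u : L) (p : K[X][Y]) (j : ℕ) : (specX u p).coeff j = aeval u (p.coeff j) :=
  coeff_map _ _

theorem aevalAeval_eq_eval_specX (u v : L) (p : K[X][Y]) :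
    aevalAeval u v p = (specX u p).eval v := by
  have h : (aevalAeval u v : K[X][Y] →ₐ[K] L).toRingHom =
      eval₂RingHom (aeval u : K[X] →ₐ[K] L).toRingHom v := by
    ext <;> simp
  rw [specX, eval_map]
  exact RingHom.congr_fun h p

theorem map_specX (ψ : L →ₐ[K] L') (u : L) (p : K[X][Y]) :
    (specX u p).map (ψ : L →+* L') = specX (ψ u) p := by
  ext j
  rw [coeff_map, coeff_specX, coeff_specX, aeval_algHom_apply]
  rfl

end SpecX

section IntermediateField

variable {L : Type*} [Field L] [Algebra K L] (F : IntermediateField K L) [IsAlgClosed F]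
  {u : L} (hu : u ∈ F) (p : K[X][Y])
include hu

theorem splits_specX : (specX u p).Splits := by
  have hmap : (specX (⟨u, hu⟩ : F) p).map (F.val : F →+* L) = specX u p := map_specX F.val _ p
  exact hmap ▸ (IsAlgClosed.splits _).map _

theorem mem_of_isRoot_specX (hp : specX u p ≠ 0) {v : L} (hv : (specX u p).IsRoot v) : v ∈ F := by
  have hmap : (specX (⟨u, hu⟩ : F) p).map (F.val : F →+* L) = specX u p := map_specX F.val _ p
  have hsplits : (specX (⟨u, hu⟩ : F) p).Splits := IsAlgClosed.splits _
  rw [← hmap] at hv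
  obtain ⟨w, rfl⟩ := hsplits.mem_range_of_isRoot
    (fun h0 => hp (by rw [← hmap, h0, Polynomial.map_zero])) hv
  exact w.2

end IntermediateField

variable {p : K[X][Y]}

theorem natDegree_coeff_le_degX (p : K[X][Y]) (j : ℕ) : (p.coeff j).natDegree ≤ degX p := by
  by_cases hj : j ∈ p.support
  · exact Finset.le_sup (f := fun j => (p.coeff j).natDegree) hj
  · rw [notMem_support_iff.1 hj, natDegree_zero]
    exact Nat.zero_le _

theorem exists_map_eq_C_mul_specX {φ : HahnSeries ℚ K} (hφ : PosDegree φ) (c : OnePoint K)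
    (p : K[X][Y]) : ∃ s : HahnSeries ℚ K, s ≠ 0 ∧ ∃ Q : (integers K)[X],
      Q.map (algebraMap _ (HahnSeries ℚ K)) = C s * specX (moebius (chart c) φ) p ∧
      ∀ j, (Q.map (res K : integers K →+* K)).coeff j = homEval c (degX p) (p.coeff j) := by
  obtain ⟨s, hs, h⟩ := exists_aeval_moebius_chart_eq hφ c (degX p)
  choose z hz hres using fun j => h (p.coeff j) (natDegree_coeff_le_degX p j)
  have hcoeff (j : ℕ) : (C s⁻¹ * specX (moebius (chart c) φ) p).coeff j = z j := by
    rw [coeff_C_mul, coeff_specX, hz, inv_mul_cancel_left₀ hs]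
  have hlift : C s⁻¹ * specX (moebius (chart c) φ) p ∈ lifts (algebraMap (integers K) _) :=
    (lifts_iff_coeff_lifts _).2 fun j => ⟨z j, (hcoeff j).symm⟩
  obtain ⟨Q, hQ⟩ := (mem_lifts _).1 hlift
  refine ⟨s⁻¹, inv_ne_zero hs, Q, hQ, fun j => ?_⟩
  have hQz : Q.coeff j = z j := Subtype.ext (by rw [← hcoeff, ← hQ, coeff_map]; rfl)
  rw [coeff_map, ← hres, hQz]
  rfl

theorem mem_curve_iff_homEval_eq_zero {t : OnePoint K × OnePoint K} {P : K[X]}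
    (hP : ∀ j, P.coeff j = homEval t.1 (degX p) (p.coeff j)) :
    t ∈ curve p ↔ homEval t.2 p.natDegree P = 0 := by
  rw [curve, Set.mem_ofPred_eq, biHom, homEval]
  simp only [hP, homEval, Finset.sum_mul]

theorem exists_homEval_coeff_ne_zero (hp : p.IsPrimitive) (c : OnePoint K) :
    ∃ j, homEval c (degX p) (p.coeff j) ≠ 0 := by
  induction c using OnePoint.rec with
  | infty =>
    obtain ⟨j, hj, h⟩ := Finset.exists_mem_eq_sup p.support (nonempty_support_iff.2 hp.ne_zero)
      fun j => (p.coeff j).natDegree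
    refine ⟨j, ?_⟩
    rw [homEval_infty, degX, h]
    exact leadingCoeff_ne_zero.2 (mem_support_iff.1 hj)
  | coe a =>
    by_contra! hcon
    refine not_isUnit_X_sub_C a (hp _ (C_dvd_iff_dvd_coeff _ _ |>.2 fun j => ?_))
    rw [dvd_iff_isRoot, IsRoot.def, ← homEval_coe a (natDegree_coeff_le_degX p j)]
    exact hcon j

theorem eval_C_ne_zero (hp : Irreducible p) (hpy : ∀ b : K[X], p ≠ b.map C) (b : K) :
    p.eval (C b) ≠ 0 := by
  intro h
  obtain ⟨q, hq⟩ := dvd_iff_isRoot.2 h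
  have hu : IsUnit q := (hp.isUnit_or_isUnit hq).resolve_left (not_isUnit_X_sub_C _)
  obtain ⟨u, hu', rfl⟩ := isUnit_iff.1 hu
  obtain ⟨k, -, rfl⟩ := isUnit_iff.1 hu'
  refine hpy ((X - C b) * C k) ?_
  rw [hq, Polynomial.map_mul, Polynomial.map_sub, map_X, map_C, map_C]

theorem not_isRoot_specX_algebraMap {L : Type*} [CommRing L] [Algebra K L] {u : L}
    (hu : Transcendental K u) (hp : Irreducible p) (hpy : ∀ b : K[X], p ≠ b.map C) (b : K) :
    ¬ (specX u p).IsRoot (algebraMap K L b) := by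
  intro h
  refine eval_C_ne_zero hp hpy b (transcendental_iff.1 hu _ ?_)
  have hC : aeval u (C b) = algebraMap K L b := aeval_C u b
  rw [← h.eq_zero, ← hC]
  exact (eval_map_apply (aeval u : K[X] →ₐ[K] L).toRingHom (C b)).symm

theorem exists_branch [IsAlgClosed K] [CharZero K] (hp : Irreducible p) (hpx : ∀ a : K[X], p ≠ C a)
    (hpy : ∀ b : K[X], p ≠ b.map C) {t : OnePoint K × OnePoint K} (ht : t ∈ curve p) :
    ∃ φ : HahnSeries ℚ K, IsPuiseux φ ∧ PosDegree φ ∧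
      aevalAeval (moebius (chart t.1) serX) (moebius (chart t.2) φ) p = 0 := by
  set u : HahnSeries ℚ K := moebius (chart t.1) serX
  have hu : Transcendental K u := posDegree_serX.transcendental_moebius_chart _
  have huF : u ∈ puiseux K :=
    (moebius_chart_mem_iff _ posDegree_serX.ne_zero _).2 (isPuiseux_single (-1) 1)
  have hinj : Function.Injective (aeval u : K[X] →ₐ[K] HahnSeries ℚ K) :=
    transcendental_iff_injective.1 hu
  have hq0 : specX u p ≠ 0 := (Polynomial.map_ne_zero_iff hinj).2 hp.ne_zero
  obtain ⟨s, hs, Q, hQ, hQres⟩ := exists_map_eq_C_mul_specX posDegree_serX t.1 p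
  have hroot (v : HahnSeries ℚ K) :
      (Q.map (algebraMap _ (HahnSeries ℚ K))).IsRoot v ↔ (specX u p).IsRoot v := by
    rw [hQ, IsRoot.def, eval_mul, eval_C, mul_eq_zero_iff_left hs, IsRoot.def]
  have hdeg : Q.natDegree = p.natDegree := by
    rw [← natDegree_map_eq_of_injective Subtype.val_injective (f := algebraMap (integers K) _), hQ,
      natDegree_C_mul hs]
    exact natDegree_map_eq_of_injective hinj p
  obtain ⟨j, hj⟩ := exists_homEval_coeff_ne_zero
    (hp.isPrimitive fun h => hpx _ (eq_C_of_natDegree_eq_zero h)) t.1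
  obtain ⟨φ, hφ, hφroot⟩ := exists_isRoot_moebius_chart (Q := Q)
    (hQ ▸ (splits_specX _ huF p).C_mul s)
    (fun h => hj (by rw [← hQres, h, coeff_zero])) t.2
    (hdeg ▸ (mem_curve_iff_homEval_eq_zero hQres).1 ht)
    fun b => (hroot _).not.2 (not_isRoot_specX_algebraMap hu hp hpy b)
  rw [hroot] at hφroot
  have hφF := mem_of_isRoot_specX (puiseux K) huF p hq0 hφroot
  exact ⟨φ, (moebius_chart_mem_iff _ hφ.ne_zero _).1 hφF, hφ,
    (aevalAeval_eq_eval_specX _ _ _).trans hφroot⟩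

end Branch

section Evaluation

variable {K : Type*} [Field K] {L : Type*} [Field L] [Algebra K L]

theorem map_aevalAeval {A B : Type*} [CommRing A] [CommRing B] [Algebra K A] [Algebra K B]
    (ψ : A →ₐ[K] B) (x y : A) (p : K[X][Y]) :
    ψ (aevalAeval x y p) = aevalAeval (ψ x) (ψ y) p := by
  rw [aevalAeval_eq_eval_specX, aevalAeval_eq_eval_specX, ← map_specX]
  exact (eval_map_apply (ψ : A →+* B) y).symm

theorem aevalAeval_mem {A : Type*} [CommRing A] [Algebra K A] {S : Subalgebra K A} {x y : A}
    (hx : x ∈ S) (hy : y ∈ S) (p : K[X][Y]) : aevalAeval x y p ∈ S :=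
  map_aevalAeval S.val ⟨x, hx⟩ ⟨y, hy⟩ p ▸ (aevalAeval (⟨x, hx⟩ : S) ⟨y, hy⟩ p).2

theorem ofPoly_ne_zero {d : K[X][Y]} : ofPoly d ≠ 0 ↔ d ≠ 0 :=
  IsFractionRing.to_map_eq_zero_iff.not

theorem ofPoly_one : ofPoly (1 : K[X][Y]) = 1 := map_one _

theorem ofPoly_numer_div_ofPoly_denom (a : RatFunc₂ K) : ofPoly (numer a) / ofPoly (denom a) = a :=
  IsFractionRing.mk'_num_den' K[X][Y] a

theorem denom_ne_zero (a : RatFunc₂ K) : denom a ≠ 0 :=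
  nonZeroDivisors.ne_zero (IsFractionRing.den K[X][Y] a).2

theorem ofPoly_ne_zero_of_map_ne_zero (e : K[X][Y] →ₐ[K] L) {d : K[X][Y]} (hd : e d ≠ 0) :
    ofPoly d ≠ 0 :=
  ofPoly_ne_zero.2 (ne_zero_of_map hd)

/-- The graph of the evaluation, through `e`, of the elements of `K(x, y)` that have a denominator
not annihilated by `e`. -/
def evalGraph (e : K[X][Y] →ₐ[K] L) : Subalgebra K (RatFunc₂ K × L) where
  carrier := {al | ∃ n d, e d ≠ 0 ∧ al = (ofPoly n / ofPoly d, e n / e d)}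
  mul_mem' ha hb := by
    rw [Set.mem_ofPred_eq] at *
    obtain ⟨n, d, hd, rfl⟩ := ha
    obtain ⟨n', d', hd', rfl⟩ := hb
    refine ⟨n * n', d * d', map_mul e d d' ▸ mul_ne_zero hd hd', ?_⟩
    simp only [map_mul, Prod.mk_mul_mk, div_mul_div_comm]
  add_mem' ha hb := by
    rw [Set.mem_ofPred_eq] at *
    obtain ⟨n, d, hd, rfl⟩ := ha
    obtain ⟨n', d', hd', rfl⟩ := hb
    refine ⟨n * d' + d * n', d * d', map_mul e d d' ▸ mul_ne_zero hd hd', ?_⟩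
    rw [Prod.mk_add_mk, div_add_div _ _ hd hd', div_add_div _ _
      (ofPoly_ne_zero_of_map_ne_zero e hd) (ofPoly_ne_zero_of_map_ne_zero e hd')]
    simp only [map_mul, map_add]
  algebraMap_mem' a := by
    rw [Set.mem_ofPred_eq]
    refine ⟨algebraMap K _ a, 1, map_one e ▸ one_ne_zero, ?_⟩
    rw [ofPoly_one, map_one, div_one, div_one, e.commutes, ofPoly, ← IsScalarTower.algebraMap_apply]
    rfl

variable {e : K[X][Y] →ₐ[K] L} {a b : RatFunc₂ K} {l m : L}

theorem mem_evalGraph : (a, l) ∈ evalGraph e ↔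
    ∃ n d, e d ≠ 0 ∧ (a, l) = (ofPoly n / ofPoly d, e n / e d) :=
  Iff.of_eq Set.mem_ofPred_eq

theorem ofPoly_mem_evalGraph (n : K[X][Y]) : (ofPoly n, e n) ∈ evalGraph e :=
  mem_evalGraph.2 ⟨n, 1, map_one e ▸ one_ne_zero, by rw [ofPoly_one, map_one, div_one, div_one]⟩

theorem div_mem_evalGraph (ha : (a, l) ∈ evalGraph e) (hb : (b, m) ∈ evalGraph e) (hm : m ≠ 0) :
    (a / b, l / m) ∈ evalGraph e := by
  obtain ⟨n, d, hd, ha⟩ := mem_evalGraph.1 ha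
  obtain ⟨n', d', _, hb⟩ := mem_evalGraph.1 hb
  obtain ⟨rfl, rfl⟩ := Prod.ext_iff.1 ha
  obtain ⟨rfl, rfl⟩ := Prod.ext_iff.1 hb
  have hden : e (d * n') ≠ 0 := map_mul e d n' ▸ mul_ne_zero hd (div_ne_zero_iff.1 hm).1
  refine mem_evalGraph.2 ⟨n * d', d * n', hden, ?_⟩
  simp only [map_mul, div_div_div_eq]

theorem map_numer_eq_mul_map_denom (h : (a, l) ∈ evalGraph e) :
    e (denom a) ≠ 0 ∧ e (numer a) = l * e (denom a) := by
  obtain ⟨n, d, hd, hal⟩ := mem_evalGraph.1 h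
  obtain ⟨ha, rfl⟩ := Prod.ext_iff.1 hal
  have hcross : numer a * d = n * denom a := by
    refine IsFractionRing.injective K[X][Y] (RatFunc₂ K) ?_
    rw [map_mul, map_mul, ← div_eq_div_iff (ofPoly_ne_zero.2 (denom_ne_zero a))
      (ofPoly_ne_zero_of_map_ne_zero e hd)]
    exact (ofPoly_numer_div_ofPoly_denom a).trans ha
  have hdvd : denom a ∣ d := (IsFractionRing.num_den_reduced K[X][Y] a).symm.dvd_of_dvd_mul_left
    ⟨n, hcross.trans (mul_comm _ _)⟩
  have hne : e (denom a) ≠ 0 := ne_zero_of_dvd_ne_zero hd (map_dvd e hdvd)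
  refine ⟨hne, ?_⟩
  rw [div_mul_eq_mul_div, eq_div_iff hd, ← map_mul, ← map_mul, hcross]

theorem evalRat_eq_of_mem_evalGraph {u v : L} (h : (a, l) ∈ evalGraph (aevalAeval u v)) :
    evalRat u v a = l := by
  obtain ⟨hne, heq⟩ := map_numer_eq_mul_map_denom h
  rw [evalRat, heq, mul_div_cancel_right₀ _ hne]

theorem evalRat_mem_evalGraph {u v : L} (h : aevalAeval u v (denom a) ≠ 0) :
    (a, evalRat u v a) ∈ evalGraph (aevalAeval u v) := by
  have hdiv := div_mem_evalGraph (ofPoly_mem_evalGraph (e := aevalAeval u v) (numer a))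
    (ofPoly_mem_evalGraph (denom a)) h
  rwa [ofPoly_numer_div_ofPoly_denom] at hdiv

theorem aeval_mem_evalGraph (ha : (a, l) ∈ evalGraph e) (h : K[X]) :
    (aeval a h, aeval l h) ∈ evalGraph e :=
  aeval_prod_apply (a, l) h ▸ aevalAeval_C (a, l) (a, l) h ▸ aevalAeval_mem ha ha (C h)

theorem aevalAeval_mem_evalGraph (ha : (a, l) ∈ evalGraph e) (hb : (b, m) ∈ evalGraph e)
    (p : K[X][Y]) : (aevalAeval a b p, aevalAeval l m p) ∈ evalGraph e := by
  have h := aevalAeval_mem ha hb p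
  rwa [← Prod.mk.eta (p := aevalAeval (a, l) (b, m) p), ← AlgHom.fst_apply K, ← AlgHom.snd_apply K,
    map_aevalAeval, map_aevalAeval] at h

theorem moebius_chart_mem_evalGraph (ha : (a, l) ∈ evalGraph e) (ha0 : a ≠ 0) (hl : l ≠ 0)
    (c : OnePoint K) : (moebius (chart c) a, moebius (chart c) l) ∈ evalGraph e := by
  induction c using OnePoint.rec with
  | infty => rwa [moebius_chart_infty, moebius_chart_infty]
  | coe c =>
    rw [moebius_chart_coe c ha0, moebius_chart_coe c hl, ← one_div, ← one_div]
    exact add_mem (div_mem_evalGraph (one_mem _) ha hl) ((evalGraph e).algebraMap_mem c)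

theorem eval_mem_evalGraph.{u} {K L : Type u} [Field K] [Field L] [Algebra K L]
    {e : K[X][Y] →ₐ[K] L} {a : RatFunc₂ K} {l : L} (ha : (a, l) ∈ evalGraph e)
    (hl : Transcendental K l) (f : RatFunc K) :
    (f.eval (algebraMap K (RatFunc₂ K)) a, f.eval (algebraMap K L) l) ∈ evalGraph e :=
  div_mem_evalGraph (aeval_mem_evalGraph ha _) (aeval_mem_evalGraph ha _)
    fun h => f.denom_ne_zero (transcendental_iff.1 hl _ h)

variable (u v : L)

theorem varX_mem_evalGraph : (varX, u) ∈ evalGraph (aevalAeval (R := K) u v) := by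
  have h := ofPoly_mem_evalGraph (e := aevalAeval (R := K) u v) (C X)
  rwa [aevalAeval_X] at h

theorem varY_mem_evalGraph : (varY, v) ∈ evalGraph (aevalAeval (R := K) u v) := by
  have h := ofPoly_mem_evalGraph (e := aevalAeval (R := K) u v) Y
  rwa [aevalAeval_Y] at h

variable {u v}

theorem compT_mem_evalGraph (hu : u ≠ 0) (hv : v ≠ 0) (c d : OnePoint K) {r : RatFunc₂ K}
    (hr : aevalAeval (moebius (chart c) u) (moebius (chart d) v) (denom r) ≠ 0) :
    (compT r (chart c) (chart d), evalRat (moebius (chart c) u) (moebius (chart d) v) r) ∈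
      evalGraph (aevalAeval (R := K) u v) := by
  have hx := moebius_chart_mem_evalGraph (varX_mem_evalGraph u v)
    (ofPoly_ne_zero.2 (C_ne_zero.2 X_ne_zero)) hu c
  have hy := moebius_chart_mem_evalGraph (varY_mem_evalGraph u v)
    (ofPoly_ne_zero.2 X_ne_zero) hv d
  exact div_mem_evalGraph (aevalAeval_mem_evalGraph hx hy _) (aevalAeval_mem_evalGraph hx hy _) hr

/- Over the field `K(x)` the polynomials `p` and `d` are coprime, so they have no common zero. -/
theorem aevalAeval_ne_zero_of_not_dvd {p d : K[X][Y]} (hp : Irreducible p) (hdeg : p.natDegree ≠ 0)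
    (hu : Transcendental K u) (h0 : aevalAeval u v p = 0) (hd : ¬ p ∣ d) :
    aevalAeval u v d ≠ 0 := by
  intro hd0
  let F := FractionRing K[X]
  have hinj : Function.Injective (aeval u : K[X] →ₐ[K] L).toRingHom :=
    transcendental_iff_injective.1 hu
  let ι : F →+* L := IsFractionRing.lift hinj
  have hι (q : K[X][Y]) : eval₂ ι v (q.map (algebraMap K[X] F)) = aevalAeval u v q := by
    rw [aevalAeval_eq_eval_specX, specX, eval_map, eval₂_map]
    exact congrArg (fun i => eval₂ i v q) (RingHom.ext (IsFractionRing.lift_algebraMap hinj))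
  have hprim : p.IsPrimitive := hp.isPrimitive hdeg
  have hirr : Irreducible (p.map (algebraMap K[X] F)) :=
    hprim.irreducible_iff_irreducible_map_fraction_map.1 hp
  obtain ⟨α, β, hαβ⟩ := hirr.coprime_iff_not_dvd.2
    fun h => hd (hprim.dvd_of_fraction_map_dvd_fraction_map h)
  apply_fun eval₂ ι v at hαβ
  rw [eval₂_add, eval₂_mul, eval₂_mul, hι, hι, h0, hd0, mul_zero, mul_zero, add_zero, eval₂_one]
    at hαβ
  exact zero_ne_one hαβ

end Evaluation

section Main

variable {K : Type*} [Field K] {p : K[X][Y]} {r : RatFunc₂ K}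

theorem eval_sub_eval_eq_evalRat.{u} {K L : Type u} [Field K] [Field L] [Algebra K L]
    {p : K[X][Y]} {r : RatFunc₂ K} (hp : Irreducible p) (hdeg : p.natDegree ≠ 0)
    (hr : r ∈ localRing p) {f g : RatFunc K} (hfg : (f, g) ∈ sepSet r p) {u v : L}
    (hu : Transcendental K u) (hv : Transcendental K v) (h0 : aevalAeval u v p = 0) :
    f.eval (algebraMap K L) u - g.eval (algebraMap K L) v = evalRat u v r := by
  obtain ⟨_, hs, h⟩ := hfg
  obtain ⟨q, hq, rfl⟩ := hs
  have hmem {a : RatFunc₂ K} (ha : a ∈ localRing p) :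
      (a, evalRat u v a) ∈ evalGraph (aevalAeval (R := K) u v) :=
    evalRat_mem_evalGraph (aevalAeval_ne_zero_of_not_dvd hp hdeg hu h0 ha)
  have hleft := sub_mem (eval_mem_evalGraph (varX_mem_evalGraph (K := K) u v) hu f)
    (eval_mem_evalGraph (varY_mem_evalGraph (K := K) u v) hv g)
  have hright := add_mem (hmem hr) (mul_mem (hmem hq) (ofPoly_mem_evalGraph p))
  rw [h0, Prod.mk_mul_mk, mul_zero, Prod.mk_add_mk, add_zero] at hright
  rw [Prod.mk_sub_mk, h] at hleft
  exact (evalRat_eq_of_mem_evalGraph hleft).symm.trans (evalRat_eq_of_mem_evalGraph hright)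

theorem isPole_of_branch (hp : Irreducible p) (hdeg : p.natDegree ≠ 0) (hr : r ∈ localRing p)
    (t : curve p) {φ : HahnSeries ℚ K} (hφ : IsPuiseux φ) (hφpos : PosDegree φ)
    (h0 : aevalAeval (moebius (chart t.1.1) serX) (moebius (chart t.1.2) φ) p = 0)
    (hpos : PosDegree (evalRat (moebius (chart t.1.1) serX) (moebius (chart t.1.2) φ) r)) :
    IsPole p r t := by
  classical
  refine ⟨(chart t.1.1)⁻¹, (chart t.1.2)⁻¹, inv_smul_eq_iff.2 (chart_smul_infty _).symm,
    inv_smul_eq_iff.2 (chart_smul_infty _).symm, φ, hφ, ?_, hφpos, ?_⟩ <;> rw [inv_inv, inv_inv]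
  · have hpmem := ofPoly_mem_evalGraph
      (e := aevalAeval (R := K) (moebius (chart t.1.1) serX) (moebius (chart t.1.2) φ)) p
    have hcomp := compT_mem_evalGraph posDegree_serX.ne_zero hφpos.ne_zero t.1.1 t.1.2
      (map_numer_eq_mul_map_denom hpmem).1
    rw [evalRat_eq_of_mem_evalGraph hpmem, h0] at hcomp
    rw [(map_numer_eq_mul_map_denom hcomp).2, zero_mul]
  · have hdenom := aevalAeval_ne_zero_of_not_dvd hp hdeg
      (posDegree_serX.transcendental_moebius_chart t.1.1) h0 hr
    rwa [evalRat_eq_of_mem_evalGraph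
      (compT_mem_evalGraph posDegree_serX.ne_zero hφpos.ne_zero t.1.1 t.1.2 hdenom)]

theorem posDegree_iff_of_sub {x y : HahnSeries ℚ K} (h : ¬ PosDegree (x - y)) :
    PosDegree x ↔ PosDegree y := by
  rw [posDegree_iff_notMem_integers, not_not] at h
  rw [posDegree_iff_notMem_integers, posDegree_iff_notMem_integers, not_iff_not,
    ← add_mem_cancel_left (y := y) h, sub_add_cancel]

theorem isPole_or_isPoleUniv_iff [IsAlgClosed K] [CharZero K] (hp : Irreducible p)
    (hpx : ∀ a : K[X], p ≠ C a) (hpy : ∀ b : K[X], p ≠ b.map C) (hr : r ∈ localRing p)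
    {f g : RatFunc K} (hfg : (f, g) ∈ sepSet r p) (t : curve p) :
    IsPole p r t ∨ (IsPoleUniv f t.1.1 ↔ IsPoleUniv g t.1.2) := by
  have hdeg : p.natDegree ≠ 0 := fun h => hpx _ (eq_C_of_natDegree_eq_zero h)
  obtain ⟨φ, hφ, hφpos, h0⟩ := exists_branch hp hpx hpy t.2
  have hsub := eval_sub_eval_eq_evalRat hp hdeg hr hfg
    (posDegree_serX.transcendental_moebius_chart t.1.1) (hφpos.transcendental_moebius_chart t.1.2)
    h0
  by_cases hpos : PosDegree (evalRat (moebius (chart t.1.1) serX) (moebius (chart t.1.2) φ) r)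
  · exact Or.inl (isPole_of_branch hp hdeg hr t hφ hφpos h0 hpos)
  · rw [isPoleUniv_iff_posDegree_eval posDegree_serX, isPoleUniv_iff_posDegree_eval hφpos]
    exact Or.inr (posDegree_iff_of_sub (hsub ▸ hpos))

theorem mem_orbit_iff_of_rel {s t t' : curve p} (h : t.1.1 = t'.1.1 ∨ t.1.2 = t'.1.2) :
    t ∈ orbit p s ↔ t' ∈ orbit p s :=
  ⟨fun ht => .trans _ _ _ ht (.rel _ _ h), fun ht => .trans _ _ _ ht (.symm _ _ (.rel _ _ h))⟩

theorem iff_of_mem_orbit {P : curve p → Prop}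
    (hP : ∀ a b : curve p, a.1.1 = b.1.1 ∨ a.1.2 = b.1.2 → (P a ↔ P b)) {s t : curve p}
    (ht : t ∈ orbit p s) : P s ↔ P t := by
  induction ht with
  | rel a b h => exact hP a b h
  | refl => exact Iff.rfl
  | symm _ _ _ ih => exact ih.symm
  | trans _ _ _ _ _ ih ih' => exact ih.trans ih'

theorem self_mem_orbit (s : curve p) : s ∈ orbit p s := .refl s

theorem orbit_finite {A B : OnePoint K → Prop} (hA : {a | A a}.Finite) (hB : {b | B b}.Finite)
    {s : curve p} (hs : A s.1.1) (hAB : ∀ t ∈ orbit p s, A t.1.1 ↔ B t.1.2) :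
    (orbit p s).Finite := by
  have hinv (a b : curve p) (h : a.1.1 = b.1.1 ∨ a.1.2 = b.1.2) :
      a ∈ orbit p s ∧ A a.1.1 ↔ b ∈ orbit p s ∧ A b.1.1 := by
    rw [mem_orbit_iff_of_rel h]
    refine and_congr_right fun hb => ?_
    rcases h with h | h
    · rw [h]
    · rw [hAB a ((mem_orbit_iff_of_rel (.inr h)).2 hb), hAB b hb, h]
  refine ((hA.prod hB).preimage Subtype.val_injective.injOn).subset fun t ht => ?_
  have hAt : A t.1.1 := ((iff_of_mem_orbit hinv ht).1 ⟨self_mem_orbit s, hs⟩).2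
  exact ⟨hAt, (hAB t ht).1 hAt⟩

end Main

end SepVar

end

theorem mainTheorem6 {K : Type*} [Field K] [IsAlgClosed K] [CharZero K]
    (p : K[X][Y]) (hp : Irreducible p) (hpx : ∀ a : K[X], p ≠ C a) (hpy : ∀ b : K[X], p ≠ b.map C)
    (r : SepVar.RatFunc₂ K) (hr : r ∈ SepVar.localRing p)
    (f g : RatFunc K) (hfg : (f, g) ∈ SepVar.sepSet r p)
    (s : SepVar.curve p) (hs : SepVar.IsPole p r s) (horb : (SepVar.orbit p s).Infinite) :
    ∃ t ∈ SepVar.orbit p s, SepVar.IsPole p r t ∧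
      (¬ SepVar.IsPoleUniv f t.1.1 ∨ ¬ SepVar.IsPoleUniv g t.1.2) := by
  by_contra! hcon
  have hiff (t) (ht : t ∈ SepVar.orbit p s) :
      SepVar.IsPoleUniv f t.1.1 ↔ SepVar.IsPoleUniv g t.1.2 :=
    (SepVar.isPole_or_isPoleUniv_iff hp hpx hpy hr hfg t).elim
      (fun hpole => iff_of_true (hcon t ht hpole).1 (hcon t ht hpole).2) id
  have hfs : SepVar.IsPoleUniv f s.1.1 := (hcon s (SepVar.self_mem_orbit s) hs).1
  exact horb (SepVar.orbit_finite (SepVar.finite_isPoleUniv f) (SepVar.finite_isPoleUniv g)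
    hfs hiff)
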